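/- **Corollary 1.4 (sum formula at roots of unity).** Let $n\ge 1$ be an integer, let $\zeta_n\in\mathbb{C}$ be a primitive $n$-th root of unity, and let $t$ be a formal parameter. For a multi-index $\mathbf{k}=(k_1,\ldots,k_l)$ of positive integers, of weight $k_1+\cdots+k_l$ and depth $l$, put $$\overline{z}_n(\mathbf{k};\zeta_n)=\sum_{n>m_1>\cdots>m_l>0}\ \prod_{a=1}^{l}\frac{\zeta_n^{(k_a-1)m_a}}{(1-\zeta_n^{m_a})^{k_a}},\qquad \overline{z}_n^t(\mathbf{k};\zeta_n)=\sum_{\mathbf{p}}\overline{z}_n(\mathbf{p};\zeta_n)\,t^{\,l-\mathrm{dep}(\mathbf{p})}\in\mathbb{C}[t],$$ where $\mathbf{p}=(k_1\Box\cdots\Box k_l)$ and the sum runs over all ways to fill each of the $l-1$ boxes $\Box$ by a comma "$,$", by "$+$" or by "$-1+$" (counted with multiplicity), and $\mathrm{dep}(\mathbf{p})$ is the number of entries of $\mathbf{p}$. Both are $1$ for the empty multi-index. For integers $k,l\ge 0$ let $$G_n^t(k,l;\zeta_n)=\sum_{\mathbf{k}}\overline{z}_n^t(\mathbf{k};\zeta_n),$$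 the sum over all multi-indices of positive integers of weight $k$ and depth $l$ (an empty sum is $0$, and $G_n^t(0,0;\zeta_n)=1$). Write $\overline{z}_n(l;\zeta_n)$ for the depth-one value at $(l)$ if $l\ge 1$, with the convention $\overline{z}_n(0;\zeta_n)=-1$. Then for all integers $k\ge l\ge 0$ the following two identities hold in $\mathbb{C}[t]$: $$G_n^t(k,l;\zeta_n)=\sum_{m=0}^{k}\frac{(-1)^m}{n^{m+1}}\sum_{\substack{i_0+\cdots+i_m=l\\ j_0+\cdots+j_m=k\\ 0\le i_a\le j_a\le n-1\ (a=0,\ldots,m)\\ j_1,\ldots,j_m\ge 1}}\ \prod_{a=0}^{m}\binom{n}{j_a+1}\,(1-t)^{i_0}(-t)^{l-i_0}$$ and $$G_n^t(k,l;\zeta_n)=-\sum_{m=0}^{k}\frac{1}{n^{m+1}}\sum_{\substack{i_0+\cdots+i_m=l\\ l_0+\cdots+l_m+j_0+\cdots+j_m=k\\ 0\le i_0\le j_0\le n-1\\ 1\le i_a\le j_a\le n-1\ (a=1,\ldots,m)\\ l_0,\ldots,l_m\ge 0}}\ \prod_{a=0}^{m}\binom{n}{j_a+1}\overline{z}_n(l_a;\zeta_n)\,(1-t)^{i_0}(-t)^{l-i_0}.$$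 -/

import Mathlib

/-- The modified finite multiple harmonic `q`-series
`∑_{n > m_1 > ⋯ > m_l > 0} ∏_a q ^ ((k_a - 1) m_a) / (1 - q ^ m_a) ^ k_a`
of a multi-index `k = (k_1, …, k_l)` of positive integers. The value at the empty multi-index
is `1`. (All multi-indices to which this is applied have positive entries, so that the
subtraction `k_a - 1` of natural numbers is the usual one.) -/
noncomputable def zBar (n : ℕ) (k : List ℕ) (q : ℂ) : ℂ :=
  ∑ m ∈ (Fintype.piFinset fun _ : Fin k.length => Finset.Ioo 0 n) with StrictAnti m,
    ∏ a : Fin k.length, q ^ ((k.get a - 1) * m a) / (1 - q ^ m a) ^ k.get a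

/-- All the ways to fill the boxes of `a □ k_1 □ ⋯ □ k_l`, each by a comma, by `+` or by `-1+`,
with multiplicity (one entry for each filling). -/
def fillBoxesFrom : ℕ → List ℕ → Multiset (List ℕ)
  | a, [] => {[a]}
  | a, b :: k =>
      (fillBoxesFrom b k).map (fun p => a :: p) + fillBoxesFrom (a + b) k +
        fillBoxesFrom (a + b - 1) k

/-- The multi-indices `p = (k_1 □ ⋯ □ k_l)`, one for each way to fill each of the `l - 1` boxes
by a comma, by `+` or by `-1+`. -/
def fillBoxes : List ℕ → Multiset (List ℕ)
  | [] => {[]}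
  | a :: k => fillBoxesFrom a k

/-- The interpolation polynomial `∑_p zBar n p q * t ^ (l - dep p)` of the modified finite
multiple harmonic `q`-series, where `p` runs over the fillings of `(k_1 □ ⋯ □ k_l)`. The formal
parameter `t` is the variable of the polynomial ring `ℂ[t]`. -/
noncomputable def zBarInterp (n : ℕ) (k : List ℕ) (q : ℂ) : Polynomial ℂ :=
  ((fillBoxes k).map fun p =>
    Polynomial.C (zBar n p q) * Polynomial.X ^ (k.length - p.length)).sum

/-- The sum of `zBarInterp n k q` over all multi-indices of positive integers of weight `w` and
depth `l`. A multi-index of weight `w` is a composition of `w`; for `w = l = 0` there is exactly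
one, the empty one. -/
noncomputable def sumZBarInterp (n w l : ℕ) (q : ℂ) : Polynomial ℂ :=
  ∑ c : Composition w with c.length = l, zBarInterp n c.blocks q

/-- The depth-one values of `zBar`, extended to the argument `0` by the convention that
the value there is `-1`. -/
noncomputable def zBarOne (n l : ℕ) (q : ℂ) : ℂ :=
  if l = 0 then -1 else zBar n [l] q

/-! Let x mark weight, y mark depth, and let F_n(x, y) be the generating series of the sums G_n^t(k,
l). Raising the upper bound from N to N + 1 multiplies F_N by (1 - q^N(1+x) + (1-t)xy) / (1 -
q^N(1+x) - txy) (`zBarInterp_series_succ`), so F_n is a quotient of two products over 0 < m < n. At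
q = ζ both products have the form ∏ (1 + xv - ζ^m(1+x)) = P(v), where P(v) = ((1+xv)^n - (1+x)^n) /
(xv - x) is `powDiffQuot`. Hence P(-ty) F_n = P((1-t)y) (`powDiffQuot_mul_zBarInterp_series`), and P
has explicit binomial coefficients. The two identities are two geometric expansions of 1/P(-ty):
around n, the constant term of P in x, and around P(0), whose inverse is -1/n times the generating
series of the depth-one values (`powDiffQuot_zero_mul_zBarOne_series`). Both times the difference is
divisible by x, so only m ≤ k reach the coefficient of x^k. -/

/-! ### Interpolated values as nested sums -/

/-- The factor `q ^ ((a - 1) * m) / (1 - q ^ m) ^ a` of the summands of `zBar`. -/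
noncomputable def zBarTerm (q : ℂ) (m a : ℕ) : ℂ := q ^ ((a - 1) * m) / (1 - q ^ m) ^ a

/-- With u = q^m this is u + (1 - u) = 1 over a common denominator. It is why `+` and `-1+` occur
together: jointly they let two adjacent summation indices coincide. -/
theorem zBarTerm_add_add_zBarTerm {q : ℂ} {m : ℕ} (hq : q ^ m ≠ 1) {a b : ℕ} (ha : 0 < a)
    (hb : 0 < b) :
    zBarTerm q m (a + b) + zBarTerm q m (a + b - 1) = zBarTerm q m a * zBarTerm q m b := by
  obtain ⟨a, rfl⟩ := Nat.exists_eq_succ_of_ne_zero ha.ne'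
  obtain ⟨b, rfl⟩ := Nat.exists_eq_succ_of_ne_zero hb.ne'
  have h : 1 - q ^ m ≠ 0 := sub_ne_zero.2 (Ne.symm hq)
  have e1 : a.succ + b.succ = a + b + 2 := by omega
  simp only [zBarTerm, e1, Nat.succ_eq_add_one, Nat.add_sub_cancel,
    show a + b + 2 - 1 = a + b + 1 by omega, add_mul, pow_add, one_mul]
  field_simp
  ring

theorem zBar_nil (n : ℕ) (q : ℂ) : zBar n [] q = 1 := by
  have h : ∀ m : Fin ([] : List ℕ).length → ℕ, StrictAnti m := fun m i => i.elim0
  simp [zBar, Finset.filter_true_of_mem fun m _ => h m]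

theorem strictAnti_fin_cons {l : ℕ} {b : ℕ} {m : Fin l → ℕ} (hb : ∀ i, m i < b)
    (hm : StrictAnti m) : StrictAnti (Fin.cons b m : Fin (l + 1) → ℕ) := by
  intro i j hij
  induction j using Fin.cases with
  | zero => exact absurd hij (by simp)
  | succ j =>
    induction i using Fin.cases with
    | zero => simpa using hb j
    | succ i => simpa using hm (by simpa using hij)

theorem zBar_cons (n a : ℕ) (k : List ℕ) (q : ℂ) :
    zBar n (a :: k) q = ∑ m ∈ Finset.Ioo 0 n, zBarTerm q m a * zBar m k q := by
  simp only [zBar, Finset.mul_sum]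
  rw [Finset.sum_sigma']
  refine Finset.sum_nbij' (fun m => ⟨m 0, fun i => m i.succ⟩)
    (fun s => (Fin.cons s.1 s.2 : Fin (k.length + 1) → ℕ)) ?_ ?_ ?_ ?_ ?_
  · intro m hm
    simp only [Finset.mem_filter, Fintype.mem_piFinset, Finset.mem_Ioo, Finset.mem_sigma] at hm ⊢
    exact ⟨hm.1 0, fun i => ⟨(hm.1 _).1, hm.2 (Fin.succ_pos i)⟩,
      fun i j hij => hm.2 (Fin.succ_lt_succ_iff.2 hij)⟩
  · rintro ⟨b, m⟩ hm
    simp only [Finset.mem_filter, Fintype.mem_piFinset, Finset.mem_Ioo, Finset.mem_sigma] at hm ⊢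
    refine ⟨fun i => ?_, strictAnti_fin_cons (fun i => (hm.2.1 i).2) hm.2.2⟩
    induction i using Fin.cases with
    | zero => exact hm.1
    | succ i => exact ⟨(hm.2.1 i).1, (hm.2.1 i).2.trans hm.1.2⟩
  · intro m _
    exact Fin.cons_self_tail m
  · rintro ⟨b, m⟩ _
    rfl
  · intro m _
    exact Fin.prod_univ_succ (n := k.length) _

theorem length_le_of_mem_fillBoxesFrom (k : List ℕ) :
    ∀ (a : ℕ), ∀ p ∈ fillBoxesFrom a k, p.length ≤ k.length + 1 := by
  induction k with
  | nil => intro a p hp; simp [fillBoxesFrom] at hp; simp [hp]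
  | cons b k ih =>
    intro a p hp
    simp only [fillBoxesFrom, Multiset.mem_add, Multiset.mem_map] at hp
    rcases hp with (⟨p, hp, rfl⟩ | hp) | hp
    · simpa using ih _ _ hp
    · exact (ih _ _ hp).trans (by simp)
    · exact (ih _ _ hp).trans (by simp)

section

open Polynomial

/-- The cofactor of `zBarTerm q m a` in the part of `zBarInterp n (a :: k) q` that has first
summation index `m`. -/
noncomputable def zBarInterpTail (q : ℂ) (m : ℕ) : List ℕ → ℂ[X]
  | [] => 1
  | b :: k => zBarInterp m (b :: k) q + X * C (zBarTerm q m b) * zBarInterpTail q m k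

theorem zBarInterp_nil (n : ℕ) (q : ℂ) : zBarInterp n [] q = 1 := by
  simp [zBarInterp, fillBoxes, zBar_nil]

/-- A comma makes the next index strictly smaller than m; the two merging fillings together let it
equal m, at the cost of one factor t. The induction keeps the first entry arbitrary because merging
replaces it by a + b or a + b - 1. -/
theorem zBarInterp_cons {q : ℂ} {n : ℕ} (hq : ∀ m ∈ Finset.Ioo 0 n, q ^ m ≠ 1) (k : List ℕ) :
    (∀ b ∈ k, 0 < b) → ∀ a : ℕ, 0 < a → zBarInterp n (a :: k) q =
      ∑ m ∈ Finset.Ioo 0 n, C (zBarTerm q m a) * zBarInterpTail q m k := by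
  induction k with
  | nil =>
    intro _ a _
    simp [zBarInterp, fillBoxes, fillBoxesFrom, zBar_cons, zBar_nil, zBarInterpTail]
  | cons b k ih =>
    intro hk a ha
    have hb : 0 < b := hk b (by simp)
    have hk' : ∀ b ∈ k, 0 < b := fun c hc => hk c (by simp [hc])
    have shift : ∀ c, ((fillBoxesFrom c k).map fun p =>
        C (zBar n p q) * X ^ ((a :: b :: k).length - p.length)).sum
          = X * zBarInterp n (c :: k) q := by
      intro c
      rw [zBarInterp, fillBoxes, ← Multiset.sum_map_mul_left]
      congr 1
      refine Multiset.map_congr rfl fun p hp => ?_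
      -- The length bound keeps the truncated subtraction honest, so a merge raises the exponent of
      -- t by exactly one.
      have := length_le_of_mem_fillBoxesFrom k c p hp
      have e : (a :: b :: k).length - p.length = (c :: k).length - p.length + 1 := by
        simp only [List.length_cons]; omega
      rw [e, pow_succ]
      ring
    have head : (((fillBoxesFrom b k).map fun p => a :: p).map fun p =>
        C (zBar n p q) * X ^ ((a :: b :: k).length - p.length)).sum
          = ∑ m ∈ Finset.Ioo 0 n, C (zBarTerm q m a) * zBarInterp m (b :: k) q := by
      simp only [zBarInterp, fillBoxes, ← Multiset.sum_map_mul_left, Multiset.map_map]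
      refine Eq.trans ?_ (Multiset.sum_map_sum_map _ _)
      congr 1
      refine Multiset.map_congr rfl fun p _ => ?_
      simp only [Function.comp_apply, zBar_cons, map_sum, map_mul, Finset.sum_mul,
        List.length_cons, Nat.add_sub_add_right, mul_assoc]
      rfl
    rw [zBarInterp, fillBoxes, fillBoxesFrom, Multiset.map_add, Multiset.map_add,
      Multiset.sum_add, Multiset.sum_add, head, shift, shift, ih hk' _ (by omega),
      ih hk' _ (by omega), add_assoc, ← mul_add, ← Finset.sum_add_distrib, Finset.mul_sum,
      ← Finset.sum_add_distrib]
    refine Finset.sum_congr rfl fun m hm => ?_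
    rw [← add_mul, ← C_add, zBarTerm_add_add_zBarTerm (hq m hm) ha hb, C_mul, zBarInterpTail]
    ring

end

/-! ### Products and sums over roots of unity -/

theorem IsPrimitiveRoot.pow_sub_pow_eq_prod_range {S : Type*} [CommRing S] [IsDomain S] {n : ℕ}
    {ζ : S} (hζ : IsPrimitiveRoot ζ n) (hn : 0 < n) (a b : S) :
    a ^ n - b ^ n = ∏ m ∈ Finset.range n, (a - ζ ^ m * b) := by
  classical
  have himg : Polynomial.nthRootsFinset n (1 : S) = (Finset.range n).image (ζ ^ ·) := by
    symm
    refine Finset.eq_of_subset_of_card_le (fun x hx => ?_) ?_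
    · obtain ⟨m, -, rfl⟩ := Finset.mem_image.1 hx
      rw [Polynomial.mem_nthRootsFinset hn, ← pow_mul, mul_comm, pow_mul, hζ.pow_eq_one, one_pow]
    · rw [hζ.card_nthRootsFinset, Finset.card_image_of_injOn, Finset.card_range]
      intro i hi j hj h
      exact hζ.pow_inj (by simpa using hi) (by simpa using hj) h
  rw [hζ.pow_sub_pow_eq_prod_sub_mul a b hn, himg, Finset.prod_image]
  intro i hi j hj h
  exact hζ.pow_inj (by simpa using hi) (by simpa using hj) h

/-- The quotient of `(1 + x * v) ^ n - (1 + x) ^ n` by `x * v - x`. -/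
def powDiffQuot {S : Type*} [CommRing S] (n : ℕ) (x v : S) : S :=
  ∑ j ∈ Finset.range n, (n.choose (j + 1) : S) * x ^ j * ∑ i ∈ Finset.range (j + 1), v ^ i

theorem mul_powDiffQuot {S : Type*} [CommRing S] (n : ℕ) (x v : S) :
    (x * v - x) * powDiffQuot n x v = (1 + x * v) ^ n - (1 + x) ^ n := by
  rw [powDiffQuot, Finset.mul_sum, add_comm 1 (x * v), add_comm 1 x, add_pow, add_pow,
    Finset.sum_range_succ', Finset.sum_range_succ' _ n]
  simp only [one_pow, mul_one, pow_zero, add_sub_add_right_eq_sub]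
  rw [← Finset.sum_sub_distrib]
  refine Finset.sum_congr rfl fun j _ => ?_
  have h := geom_sum_mul v (j + 1)
  rw [mul_pow]
  linear_combination (n.choose (j + 1) : S) * x ^ (j + 1) * h

theorem dvd_powDiffQuot_sub {S : Type*} [CommRing S] {n : ℕ} (hn : 0 < n) (x v : S) :
    x ∣ powDiffQuot n x v - n := by
  obtain ⟨n, rfl⟩ := Nat.exists_eq_succ_of_ne_zero hn.ne'
  rw [powDiffQuot, Finset.sum_range_succ']
  simp only [Finset.range_one, Finset.sum_singleton, pow_zero, mul_one, zero_add,
    Nat.choose_one_right, add_sub_cancel_right]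
  refine Finset.dvd_sum fun j _ => ?_
  exact ((dvd_pow_self x (Nat.succ_ne_zero j)).mul_left _).mul_right _

theorem dvd_powDiffQuot_sub_powDiffQuot {S : Type*} [CommRing S] {n : ℕ} (hn : 0 < n)
    (x v w : S) : x ∣ powDiffQuot n x v - powDiffQuot n x w := by
  have h := dvd_sub (dvd_powDiffQuot_sub hn x v) (dvd_powDiffQuot_sub hn x w)
  rwa [sub_sub_sub_cancel_right] at h

/-- In the factorization of (1+xv)^n - (1+x)^n the factor m = 0 is xv - x, which cancels. -/
theorem IsPrimitiveRoot.prod_Ioo_eq_powDiffQuot {S : Type*} [CommRing S] [IsDomain S] {n : ℕ}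
    {ζ : S} (hζ : IsPrimitiveRoot ζ n) (hn : 0 < n) {x v : S} (h : x * v - x ≠ 0) :
    ∏ m ∈ Finset.Ioo 0 n, (1 + x * v - ζ ^ m * (1 + x)) = powDiffQuot n x v := by
  refine mul_left_cancel₀ h ?_
  rw [mul_powDiffQuot, hζ.pow_sub_pow_eq_prod_range hn, Finset.range_eq_Ico,
    ← Finset.mul_prod_Ioo_eq_prod_Ico hn]
  congr 1
  ring

theorem IsPrimitiveRoot.sum_range_pow_pow {S : Type*} [CommRing S] [IsDomain S] {n : ℕ} {ζ : S}
    (hζ : IsPrimitiveRoot ζ n) {r : ℕ} (hr0 : 0 < r) (hr : r < n) :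
    ∑ m ∈ Finset.range n, (ζ ^ m) ^ r = 0 := by
  have h1 : ζ ^ r - 1 ≠ 0 := sub_ne_zero.2 (hζ.pow_ne_one_of_pos_of_lt hr0.ne' hr)
  have h2 := mul_geom_sum (ζ ^ r) n
  rw [← pow_mul, mul_comm r n, pow_mul, hζ.pow_eq_one, one_pow, sub_self] at h2
  simpa [← pow_mul, mul_comm r] using (mul_eq_zero.1 h2).resolve_left h1

/-- The partial fraction decomposition of `n / (1 - b ^ n)`, where `g m` is
`x / (1 - ζ ^ m * b)`. -/
theorem IsPrimitiveRoot.mul_sum_Ioo_eq {S : Type*} [CommRing S] [IsDomain S] {n : ℕ} {ζ : S}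
    (hζ : IsPrimitiveRoot ζ n) (hn : 0 < n) (b x : S) (g : ℕ → S)
    (hg : ∀ m ∈ Finset.Ioo 0 n, (1 - ζ ^ m * b) * g m = x) :
    (1 - b ^ n) * ∑ m ∈ Finset.Ioo 0 n, g m =
      x * (n - ∑ r ∈ Finset.range n, b ^ r) := by
  have key : ∀ m ∈ Finset.Ioo 0 n,
      (1 - b ^ n) * g m = x * ∑ r ∈ Finset.range n, (ζ ^ m) ^ r * b ^ r := by
    intro m hm
    have h := mul_neg_geom_sum (ζ ^ m * b) n
    rw [mul_pow, ← pow_mul, mul_comm m n, pow_mul, hζ.pow_eq_one, one_pow, one_mul] at h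
    simp only [mul_pow] at h
    rw [← h, ← hg m hm]
    ring
  -- Orthogonality: only r = 0 survives the sum over m. The term m = 0 is removed afterwards.
  have hsum : ∑ m ∈ Finset.range n, ∑ r ∈ Finset.range n, (ζ ^ m) ^ r * b ^ r = n := by
    rw [Finset.sum_comm]
    simp only [← Finset.sum_mul]
    rw [Finset.sum_eq_single_of_mem 0 (by simpa using hn)]
    · simp
    · intro r hr hr0
      rw [hζ.sum_range_pow_pow (Nat.pos_of_ne_zero hr0) (by simpa using hr), zero_mul]
  rw [Finset.range_eq_Ico, ← Finset.add_sum_Ioo_eq_sum_Ico hn, ← Finset.range_eq_Ico] at hsum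
  rw [Finset.mul_sum, Finset.sum_congr rfl key, ← Finset.mul_sum, ← hsum]
  simp

/-- The expansion of `F = N / (D₀ + D₁)` at `D₀ = V⁻¹`, with remainder. -/
theorem eq_geom_expansion_of_mul_eq {S : Type*} [CommRing S] {D₀ D₁ V F N : S}
    (hV : D₀ * V = 1) (h : (D₀ + D₁) * F = N) (k : ℕ) :
    F = ∑ m ∈ Finset.range (k + 1), (-1) ^ m * V ^ (m + 1) * (N * D₁ ^ m) +
      (-(V * D₁)) ^ (k + 1) * F := by
  induction k with
  | zero =>
    simp only [zero_add, Finset.range_one, Finset.sum_singleton]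
    linear_combination V * h - F * hV
  | succ k ih =>
    rw [Finset.sum_range_succ]
    have h3 : F = V * N - V * D₁ * F := by linear_combination V * h - F * hV
    have h4 : (-1 : S) ^ (k + 1) * V ^ (k + 1 + 1) * (N * D₁ ^ (k + 1)) =
        (-(V * D₁)) ^ (k + 1) * (V * N) := by
      rw [← neg_one_mul (V * D₁), mul_pow, mul_pow]; ring
    rw [h4]
    linear_combination ih + (-(V * D₁)) ^ (k + 1) * h3

/-! ### Generating series in weight and depth -/

section

open PowerSeries

/-- The multi-indices of positive integers of weight `w` and depth `l`. -/
def multiIndices (l w : ℕ) : Finset (List ℕ) :=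
  (Finset.univ.filter fun c : Composition w => c.length = l).image Composition.blocks

theorem mem_multiIndices {l w : ℕ} {k : List ℕ} :
    k ∈ multiIndices l w ↔ (∀ a ∈ k, 0 < a) ∧ k.sum = w ∧ k.length = l := by
  simp only [multiIndices, Finset.mem_image, Finset.mem_filter, Finset.mem_univ, true_and]
  constructor
  · rintro ⟨c, hc, rfl⟩
    exact ⟨fun a ha => c.blocks_pos ha, c.blocks_sum, hc⟩
  · rintro ⟨h1, h2, h3⟩
    exact ⟨⟨k, fun {a} ha => h1 a ha, h2⟩, h3, rfl⟩

theorem sumZBarInterp_eq_sum_multiIndices (n w l : ℕ) (q : ℂ) :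
    sumZBarInterp n w l q = ∑ k ∈ multiIndices l w, zBarInterp n k q := by
  rw [multiIndices, Finset.sum_image (fun c _ d _ h => Composition.ext h), sumZBarInterp]

theorem sum_multiIndices_succ {M : Type*} [AddCommMonoid M] (l w : ℕ) (φ : List ℕ → M) :
    ∑ k ∈ multiIndices (l + 1) w, φ k = ∑ s ∈ Finset.HasAntidiagonal.antidiagonal w,
      if s.1 = 0 then 0 else ∑ k ∈ multiIndices l s.2, φ (s.1 :: k) := by
  simp only [← ite_not (_ = 0)]
  rw [← Finset.sum_filter, Finset.sum_sigma']
  refine Finset.sum_nbij' (fun k => ⟨(k.headI, k.tail.sum), k.tail⟩) (fun s => s.1.1 :: s.2)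
    ?_ ?_ ?_ ?_ ?_
  · intro k hk
    obtain ⟨h1, h2, h3⟩ := mem_multiIndices.1 hk
    cases k with
    | nil => simp at h3
    | cons a k =>
      have ha := h1 a (by simp)
      simp only [Finset.mem_sigma, Finset.mem_filter, Finset.HasAntidiagonal.mem_antidiagonal, mem_multiIndices]
      exact ⟨⟨by simpa using h2, ha.ne'⟩, fun b hb => h1 b (by simpa using Or.inr hb), trivial,
        by simpa using h3⟩
  · rintro ⟨⟨a, b⟩, k⟩ hs
    simp only [Finset.mem_sigma, Finset.mem_filter, Finset.HasAntidiagonal.mem_antidiagonal,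
      mem_multiIndices] at hs ⊢
    obtain ⟨⟨h1, h2⟩, h3, h4, h5⟩ := hs
    refine ⟨?_, by simp [h4, h1], by simp [h5]⟩
    simpa using ⟨Nat.pos_of_ne_zero h2, h3⟩
  · intro k hk
    obtain ⟨h1, h2, h3⟩ := mem_multiIndices.1 hk
    cases k with
    | nil => simp at h3
    | cons a k => rfl
  · rintro ⟨⟨a, b⟩, k⟩ hs
    simp only [Finset.mem_sigma, mem_multiIndices] at hs
    simp [hs.2.2.1]
  · intro k hk
    obtain ⟨h1, h2, h3⟩ := mem_multiIndices.1 hk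
    cases k with
    | nil => simp at h3
    | cons a k => rfl

/-- The generating series of a function of multi-indices: the inner variable marks the weight and
the outer one the depth. -/
noncomputable def multiIndexSeries {R : Type*} [CommRing R] (φ : List ℕ → R) : R⟦X⟧⟦X⟧ :=
  mk fun l => mk fun w => ∑ k ∈ multiIndices l w, φ k

/-- The generating series of a function of positive integers. -/
noncomputable def partSeries {R : Type*} [CommRing R] (ψ : ℕ → R) : R⟦X⟧ :=
  mk fun a => if a = 0 then 0 else ψ a

theorem multiIndexSeries_sub {R : Type*} [CommRing R] (φ χ : List ℕ → R) :
    multiIndexSeries (fun k => φ k - χ k) = multiIndexSeries φ - multiIndexSeries χ := by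
  ext l w
  simp [multiIndexSeries]

theorem multiIndices_zero (w : ℕ) : multiIndices 0 w = if w = 0 then {[]} else ∅ := by
  ext k
  rw [mem_multiIndices]
  split_ifs with h
  · subst h
    simp only [List.length_eq_zero_iff, Finset.mem_singleton]
    constructor
    · exact fun h => h.2.2
    · rintro rfl; simp
  · simp only [List.length_eq_zero_iff, Finset.notMem_empty, iff_false]
    rintro ⟨-, h1, rfl⟩
    exact h (by simpa using h1.symm)

/-- Splitting off the first entry is a convolution in the weight and raises the depth by one, hence
the product with `partSeries` and the factor `X`. -/
theorem multiIndexSeries_eq_of_cons {R : Type*} [CommRing R] (s : Finset ℕ) (φ : List ℕ → R)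
    (ψ : ℕ → ℕ → R) (χ : ℕ → List ℕ → R)
    (h : ∀ a k, 0 < a → (∀ b ∈ k, 0 < b) → φ (a :: k) = ∑ m ∈ s, ψ m a * χ m k) :
    multiIndexSeries φ = C (C (φ [])) +
      X * ∑ m ∈ s, C (partSeries (ψ m)) * multiIndexSeries (χ m) := by
  ext l w
  cases l with
  | zero =>
    simp only [multiIndexSeries, coeff_mk, map_add, coeff_zero_X_mul, add_zero, coeff_zero_C,
      multiIndices_zero]
    split_ifs with hw <;> simp [coeff_C, hw]
  | succ l =>
    simp only [map_add, coeff_succ_X_mul, coeff_C_of_ne_zero (Nat.succ_ne_zero l), map_sum,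
      coeff_C_mul, zero_add]
    simp only [multiIndexSeries, coeff_mk, sum_multiIndices_succ, coeff_mul, partSeries]
    rw [Finset.sum_comm]
    refine Finset.sum_congr rfl fun t _ => ?_
    split_ifs with ht
    · simp
    · simp only [Finset.mul_sum]
      rw [Finset.sum_comm]
      exact Finset.sum_congr rfl fun k hk =>
        h _ _ (Nat.pos_of_ne_zero ht) (mem_multiIndices.1 hk).1

/-- The generating series of the `zBarTerm q m a`, that is, the expansion of
`x / (1 - q ^ m * (1 + x))`. -/
noncomputable def zBarTermSeries (q : ℂ) (m : ℕ) : (Polynomial ℂ)⟦X⟧ :=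
  partSeries fun a => Polynomial.C (zBarTerm q m a)

theorem mul_zBarTermSeries {q : ℂ} {m : ℕ} (hq : q ^ m ≠ 1) :
    (1 - C (Polynomial.C q) ^ m * (1 + X)) * zBarTermSeries q m = X := by
  have h : 1 - q ^ m ≠ 0 := sub_ne_zero.2 (Ne.symm hq)
  have e : (1 - C (Polynomial.C q) ^ m * (1 + X)) * zBarTermSeries q m =
      C (Polynomial.C (1 - q ^ m)) * zBarTermSeries q m -
        C (Polynomial.C (q ^ m)) * (X * zBarTermSeries q m) := by
    simp only [map_sub, map_pow, map_one]; ring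
  rw [e]
  ext1 a
  rw [map_sub, coeff_C_mul, coeff_C_mul]
  match a with
  | 0 => simp [zBarTermSeries, partSeries]
  | 1 =>
    simp only [coeff_one_X, coeff_succ_X_mul, zBarTermSeries, partSeries, coeff_mk]
    simp only [one_ne_zero, if_false, if_true, mul_zero, sub_zero, ← map_mul, zBarTerm]
    simp [mul_inv_cancel₀ h]
  | a + 2 =>
    simp only [coeff_succ_X_mul, zBarTermSeries, partSeries, coeff_mk, coeff_X]
    simp only [Nat.succ_ne_zero, if_false, ← map_mul, zBarTerm, ← map_sub,
      show a + 2 ≠ 1 by omega]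
    rw [Polynomial.C_eq_zero]
    simp only [show a + 2 - 1 = a + 1 by omega, Nat.add_sub_cancel, add_mul, one_mul, pow_add]
    field_simp
    ring

theorem zBarInterp_series_succ {q : ℂ} {N : ℕ} (hN : 0 < N)
    (hq : ∀ m ∈ Finset.Ioo 0 (N + 1), q ^ m ≠ 1) :
    (1 - C (C (Polynomial.C q)) ^ N * (1 + C X) - C (C Polynomial.X) * C X * X) *
        multiIndexSeries (fun k => zBarInterp (N + 1) k q) =
      (1 - C (C (Polynomial.C q)) ^ N * (1 + C X) + C (C (1 - Polynomial.X)) * C X * X) *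
        multiIndexSeries (fun k => zBarInterp N k q) := by
  have hsub : Finset.Ioo 0 N ⊆ Finset.Ioo 0 (N + 1) := Finset.Ioo_subset_Ioo_right N.le_succ
  have e1 := multiIndexSeries_eq_of_cons (Finset.Ioo 0 (N + 1))
    (fun k => zBarInterp (N + 1) k q) (fun m a => Polynomial.C (zBarTerm q m a))
    (fun m k => zBarInterpTail q m k) fun a k ha hk => zBarInterp_cons hq k hk a ha
  have e2 := multiIndexSeries_eq_of_cons (Finset.Ioo 0 N)
    (fun k => zBarInterp N k q) (fun m a => Polynomial.C (zBarTerm q m a))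
    (fun m k => zBarInterpTail q m k)
    fun a k ha hk => zBarInterp_cons (fun m hm => hq m (hsub hm)) k hk a ha
  have e3 := multiIndexSeries_eq_of_cons {N}
    (fun k => zBarInterpTail q N k - zBarInterp N k q)
    (fun m a => Polynomial.X * Polynomial.C (zBarTerm q m a))
    (fun m k => zBarInterpTail q m k) fun a k ha hk => by simp [zBarInterpTail]
  have e4 : partSeries (fun a => Polynomial.X * Polynomial.C (zBarTerm q N a)) =
      C Polynomial.X * zBarTermSeries q N := by
    ext1 a
    simp [partSeries, zBarTermSeries, coeff_C_mul]
  have e5 := congrArg (C (R := (Polynomial ℂ)⟦X⟧))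
    (mul_zBarTermSeries (hq N (by simp [hN])))
  rw [multiIndexSeries_sub, Finset.sum_singleton, e4] at e3
  have hI : Finset.Ioo 0 (N + 1) = insert N (Finset.Ioo 0 N) := by
    ext m; simp only [Finset.mem_Ioo, Finset.mem_insert]; omega
  rw [hI, Finset.sum_insert (by simp)] at e1
  simp only [zBarInterp_nil] at e1 e2
  simp only [zBarInterp_nil, zBarInterpTail, sub_self, map_zero, zero_add, map_mul] at e3
  simp only [map_mul, map_sub, map_one, map_pow, map_add] at e5
  rw [mul_add, ← add_assoc, add_right_comm, ← e2] at e1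
  change _ = _ + X * (C (zBarTermSeries q N) * _) at e1
  simp only [map_sub, map_one]
  set T := multiIndexSeries fun k => zBarInterpTail q N k
  set Z := multiIndexSeries fun k => zBarInterp N k q
  set g := C (zBarTermSeries q N)
  rw [e1]
  linear_combination C X * X * e3 + X * T * e5

-- The one-step ratios telescope from the empty index range, where the series is 1.
theorem multiIndexSeries_zBarInterp {q : ℂ} {N : ℕ}
    (hq : ∀ m ∈ Finset.Ioo 0 (N + 1), q ^ m ≠ 1) :
    (∏ m ∈ Finset.Ioo 0 (N + 1),
        (1 - C (C (Polynomial.C q)) ^ m * (1 + C X) - C (C Polynomial.X) * C X * X)) *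
        multiIndexSeries (fun k => zBarInterp (N + 1) k q) =
      ∏ m ∈ Finset.Ioo 0 (N + 1),
        (1 - C (C (Polynomial.C q)) ^ m * (1 + C X) +
          C (C (1 - Polynomial.X)) * C X * (X : (Polynomial ℂ)⟦X⟧⟦X⟧)) := by
  induction N with
  | zero =>
    have e := multiIndexSeries_eq_of_cons (Finset.Ioo 0 1)
      (fun k => zBarInterp 1 k q) (fun m a => Polynomial.C (zBarTerm q m a))
      (fun m k => zBarInterpTail q m k) fun a k ha hk => zBarInterp_cons hq k hk a ha
    have hI : Finset.Ioo 0 1 = (∅ : Finset ℕ) := by decide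
    simp only [zero_add, hI, Finset.prod_empty, one_mul]
    rw [e, hI]
    simp [zBarInterp_nil]
  | succ N ih =>
    have hI : Finset.Ioo 0 (N + 1 + 1) = insert (N + 1) (Finset.Ioo 0 (N + 1)) := by
      ext m; simp only [Finset.mem_Ioo, Finset.mem_insert]; omega
    rw [hI, Finset.prod_insert (by simp), Finset.prod_insert (by simp),
      ← ih fun m hm => hq m (Finset.Ioo_subset_Ioo_right (N + 1).le_succ hm)]
    linear_combination (∏ m ∈ Finset.Ioo 0 (N + 1),
        (1 - C (C (Polynomial.C q)) ^ m * (1 + C X) - C (C Polynomial.X) * C X * X)) *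
        zBarInterp_series_succ (N := N + 1) (by omega) hq

/-! ### Extraction of coefficients -/

theorem PowerSeries.coeff_prod_univ {R ι : Type*} [CommRing R] [Fintype ι] [DecidableEq ι]
    (f : ι → R⟦X⟧) (d : ℕ) :
    coeff d (∏ a, f a) =
      ∑ i ∈ Finset.piAntidiag (Finset.univ : Finset ι) d, ∏ a, coeff (i a) (f a) := by
  rw [coeff_prod]
  refine Finset.sum_nbij' (fun i => ⇑i) Finsupp.equivFunOnFinite.symm ?_ ?_ ?_ ?_ ?_
  · intro i hi
    simpa using hi
  · intro i hi
    simpa using hi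
  · intro i _; ext; rfl
  · intro i _; rfl
  · intro i _; rfl

/-- The coefficients of `N * D ^ m` when those of `N` and `D` are `c j * w ^ i`, resp.
`c j * v ^ i`, for certain pairs `(i, j)` and zero for the others. -/
theorem coeff_coeff_mul_pow {R : Type*} [CommRing R] {N D : R⟦X⟧⟦X⟧} {P Q : ℕ → ℕ → Prop}
    [∀ i j, Decidable (P i j)] [∀ i j, Decidable (Q i j)] {c : ℕ → R} {w v : R}
    (hN : ∀ i j, coeff j (coeff i N) = if P i j then c j * w ^ i else 0)
    (hD : ∀ i j, coeff j (coeff i D) = if P i j ∧ Q i j then c j * v ^ i else 0) (k l m : ℕ) :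
    coeff k (coeff l (N * D ^ m)) =
      ∑ i ∈ Finset.piAntidiag (Finset.univ : Finset (Fin (m + 1))) l,
        ∑ j ∈ Finset.piAntidiag (Finset.univ : Finset (Fin (m + 1))) k with
            (∀ a, P (i a) (j a)) ∧ ∀ a, a ≠ 0 → Q (i a) (j a),
          (∏ a, c (j a)) * w ^ i 0 * v ^ (l - i 0) := by
  have hprod : N * D ^ m = ∏ a : Fin (m + 1), if a = 0 then N else D := by
    simp [Fin.prod_univ_succ]
  rw [hprod, coeff_prod_univ, map_sum]
  refine Finset.sum_congr rfl fun i hi => ?_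
  have hl : l - i 0 = ∑ a : Fin m, i a.succ := by
    have := (Finset.mem_piAntidiag.1 hi).1
    rw [← this, Fin.sum_univ_succ, Nat.add_sub_cancel_left]
  rw [coeff_prod_univ, Finset.sum_filter]
  refine Finset.sum_congr rfl fun j _ => ?_
  have hterm : ∀ a : Fin (m + 1), coeff (j a) (coeff (i a) (if a = 0 then N else D)) =
      if P (i a) (j a) ∧ (a ≠ 0 → Q (i a) (j a)) then
        c (j a) * (if a = 0 then w else v) ^ i a else 0 := by
    intro a
    by_cases ha : a = 0
    · simp [ha, hN]
    · simp [ha, hD]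
  rw [Finset.prod_congr rfl fun a _ => hterm a, Finset.prod_ite_zero]
  simp only [Finset.mem_univ, true_imp_iff, forall_and]
  congr 1
  rw [Finset.prod_mul_distrib, mul_assoc, Fin.prod_univ_succ (fun a => _ ^ i a), hl,
    ← Finset.prod_pow_eq_pow_sum]
  simp

theorem coeff_coeff_powDiffQuot {R : Type*} [CommRing R] (n : ℕ) (w : R) (i j : ℕ) :
    coeff j (coeff i (powDiffQuot n (C X) (C (C w) * X : R⟦X⟧⟦X⟧))) =
      if i ≤ j ∧ j ≤ n - 1 then (n.choose (j + 1) : R) * w ^ i else 0 := by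
  have hterm : ∀ a b : ℕ, coeff j (coeff i ((n.choose (a + 1) : R⟦X⟧⟦X⟧) * C X ^ a *
      (C (C w) * X) ^ b)) =
        if i = b then if j = a then (n.choose (a + 1) : R) * w ^ b else 0 else 0 := by
    intro a b
    have e : (n.choose (a + 1) : R⟦X⟧⟦X⟧) * C X ^ a * (C (C w) * X) ^ b =
        C (C ((n.choose (a + 1) : R) * w ^ b) * X ^ a) * X ^ b := by
      simp only [map_mul, map_pow, map_natCast]; ring
    rw [e, coeff_C_mul_X_pow, apply_ite (coeff j), coeff_C_mul_X_pow, map_zero]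
  simp only [powDiffQuot, Finset.mul_sum, map_sum, hterm]
  have hb : ∀ a, ∑ b ∈ Finset.range (a + 1),
      (if i = b then if j = a then (n.choose (a + 1) : R) * w ^ b else 0 else 0) =
        if j = a then if i ≤ j then (n.choose (j + 1) : R) * w ^ i else 0 else 0 := by
    intro a
    rw [Finset.sum_ite_eq]
    by_cases h : j = a
    · simp [h]
    · simp [h]
  simp only [hb, Finset.sum_ite_eq, Finset.mem_range]
  by_cases hj : j < n
  · simp [hj, Nat.le_sub_one_of_lt hj]
  -- For n = 0 the truncated bound j ≤ n - 1 still admits j = 0, but the binomial coefficient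
  -- vanishes.
  · simp [hj, Nat.choose_eq_zero_of_lt (show n < j + 1 by omega)]

theorem coeff_coeff_eq_sum_of_mul_eq {R : Type*} [CommRing R] {D₀ D₁ V F N : R⟦X⟧⟦X⟧}
    (hV : D₀ * V = 1) (hD₁ : C X ∣ D₁) (h : (D₀ + D₁) * F = N) (k l : ℕ) :
    coeff k (coeff l F) = ∑ m ∈ Finset.range (k + 1),
      coeff k (coeff l ((-1) ^ m * V ^ (m + 1) * (N * D₁ ^ m))) := by
  obtain ⟨E, rfl⟩ := hD₁
  have e := eq_geom_expansion_of_mul_eq hV h k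
  -- The remainder carries x^(k+1), so it cannot contribute to the coefficient of x^k.
  have e' : (-(V * (C X * E))) ^ (k + 1) * F = C (X ^ (k + 1)) * ((-(V * E)) ^ (k + 1) * F) := by
    rw [map_pow, show -(V * (C X * E)) = C X * -(V * E) by ring, mul_pow]; ring
  conv_lhs => rw [e, e']
  rw [map_add, map_add, coeff_C_mul, coeff_X_pow_mul', if_neg (by omega), add_zero, map_sum,
    map_sum]

/-! ### Closed forms at a primitive root of unity -/

theorem powDiffQuot_mul_zBarInterp_series {n : ℕ} (hn : 0 < n) {ζ : ℂ}
    (hζ : IsPrimitiveRoot ζ n) :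
    powDiffQuot n (C X) (C (C (-Polynomial.X)) * X) *
        multiIndexSeries (fun k => zBarInterp n k ζ) =
      powDiffQuot n (C X) (C (C (1 - Polynomial.X)) * (X : (Polynomial ℂ)⟦X⟧⟦X⟧)) := by
  have hroot : IsPrimitiveRoot (C (C (Polynomial.C ζ)) : (Polynomial ℂ)⟦X⟧⟦X⟧) n :=
    hζ.map_of_injective (f := ((C (R := (Polynomial ℂ)⟦X⟧)).comp
      (C (R := Polynomial ℂ))).comp Polynomial.C)
      ((C_injective.comp C_injective).comp Polynomial.C_injective)
  have hne : ∀ w : Polynomial ℂ, C X * (C (C w) * X) - C X ≠ (0 : (Polynomial ℂ)⟦X⟧⟦X⟧) := by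
    intro w h
    have := congrArg (fun f => coeff 1 (coeff 0 f)) h
    simp at this
  rw [← hroot.prod_Ioo_eq_powDiffQuot hn (hne _), ← hroot.prod_Ioo_eq_powDiffQuot hn (hne _)]
  obtain ⟨N, rfl⟩ := Nat.exists_eq_succ_of_ne_zero hn.ne'
  have h := multiIndexSeries_zBarInterp (q := ζ) (N := N) fun m hm =>
    hζ.pow_ne_one_of_pos_of_lt (Finset.mem_Ioo.1 hm).1.ne' (Finset.mem_Ioo.1 hm).2
  convert h using 2
  · refine Finset.prod_congr rfl fun m _ => ?_
    simp only [map_neg]; ring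
  · ring

/-- Partial fractions at b = 1 + x, combined with xP(0) = (1+x)^n - 1. The convention -1 at argument
0 supplies the constant term that cancels the geometric sum. -/
theorem powDiffQuot_zero_mul_zBarOne_series {n : ℕ} (hn : 0 < n) {ζ : ℂ}
    (hζ : IsPrimitiveRoot ζ n) :
    powDiffQuot n (X : (Polynomial ℂ)⟦X⟧) 0 * mk (fun l => Polynomial.C (zBarOne n l ζ)) = -n := by
  have hroot : IsPrimitiveRoot (C (Polynomial.C ζ) : (Polynomial ℂ)⟦X⟧) n :=
    hζ.map_of_injective (f := (C (R := Polynomial ℂ)).comp Polynomial.C)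
      (C_injective.comp Polynomial.C_injective)
  have h1 := mul_powDiffQuot n (X : (Polynomial ℂ)⟦X⟧) 0
  have h2 := hroot.mul_sum_Ioo_eq hn (1 + X) X (zBarTermSeries ζ) fun m hm =>
    mul_zBarTermSeries (hζ.pow_ne_one_of_pos_of_lt (Finset.mem_Ioo.1 hm).1.ne'
      (Finset.mem_Ioo.1 hm).2)
  have h3 := mul_geom_sum (1 + X : (Polynomial ℂ)⟦X⟧) n
  have h4 : (mk fun l => Polynomial.C (zBarOne n l ζ)) =
      ∑ m ∈ Finset.Ioo 0 n, zBarTermSeries ζ m - 1 := by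
    ext1 l
    simp only [coeff_mk, map_sub, map_sum, zBarTermSeries, partSeries, zBarOne, coeff_one]
    split_ifs with hl
    · simp
    · simp [zBar_cons, zBar_nil]
  rw [h4]
  refine mul_left_cancel₀ (X_ne_zero (R := Polynomial ℂ)) ?_
  simp only [mul_zero, zero_sub, add_zero, one_pow] at h1
  linear_combination (-(∑ m ∈ Finset.Ioo 0 n, zBarTermSeries ζ m) + 1) * h1 - h2 + h3

/-- Subtracting n removes exactly the term j = 0, whence the condition j_a ≥ 1 of the first
identity; subtracting P(0) instead removes the terms i = 0, whence i_a ≥ 1 in the second. -/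
theorem coeff_coeff_powDiffQuot_sub_natCast {R : Type*} [CommRing R] (n : ℕ) (w : R)
    (i j : ℕ) :
    coeff j (coeff i (powDiffQuot n (C X) (C (C w) * X) - (n : R⟦X⟧⟦X⟧))) =
      if (i ≤ j ∧ j ≤ n - 1) ∧ 1 ≤ j then (n.choose (j + 1) : R) * w ^ i else 0 := by
  have e : (n : R⟦X⟧⟦X⟧) = C (C (n : R)) := by simp
  rw [map_sub, map_sub, coeff_coeff_powDiffQuot, e, coeff_C, apply_ite (coeff j), coeff_C, map_zero]
  rcases Nat.eq_zero_or_pos j with rfl | hj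
  · rcases Nat.eq_zero_or_pos i with rfl | hi
    · simp
    · simp [hi.ne']
  · simp [hj.ne', Nat.one_le_iff_ne_zero]

theorem coeff_coeff_powDiffQuot_sub_zero {R : Type*} [CommRing R] (n : ℕ) (w : R) (i j : ℕ) :
    coeff j (coeff i (powDiffQuot n (C X) (C (C w) * X : R⟦X⟧⟦X⟧) - powDiffQuot n (C X) 0)) =
      if (i ≤ j ∧ j ≤ n - 1) ∧ 1 ≤ i then (n.choose (j + 1) : R) * w ^ i else 0 := by
  have h0 := coeff_coeff_powDiffQuot n (0 : R) i j
  rw [map_zero, map_zero, zero_mul] at h0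
  rw [map_sub, map_sub, coeff_coeff_powDiffQuot, h0]
  rcases Nat.eq_zero_or_pos i with rfl | hi
  · simp
  · simp [hi.ne', Nat.one_le_iff_ne_zero]

theorem sumZBarInterp_eq_coeff (n w l : ℕ) (q : ℂ) :
    sumZBarInterp n w l q =
      coeff w (coeff l (multiIndexSeries fun k => zBarInterp n k q)) := by
  simp [sumZBarInterp_eq_sum_multiIndices, multiIndexSeries]

theorem coeff_coeff_powDiffQuot_one_sub_X (n i j : ℕ) :
    coeff j (coeff i (powDiffQuot n (C X)
      (C (C (1 - Polynomial.X)) * (X : (Polynomial ℂ)⟦X⟧⟦X⟧)))) =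
        if i ≤ j ∧ j ≤ n - 1 then
          Polynomial.C (n.choose (j + 1) : ℂ) * (1 - Polynomial.X) ^ i else 0 := by
  simpa only [map_natCast] using coeff_coeff_powDiffQuot n (1 - Polynomial.X) i j

/-! ### The two expansions -/

theorem sumZBarInterp_eq_sum_choose (n : ℕ) (hn : 0 < n) (ζ : ℂ)
    (hζ : IsPrimitiveRoot ζ n) (k l : ℕ) :
    sumZBarInterp n k l ζ =
      ∑ m ∈ Finset.range (k + 1), Polynomial.C ((-1 : ℂ) ^ m / (n : ℂ) ^ (m + 1)) *
        ∑ i ∈ Finset.piAntidiag (Finset.univ : Finset (Fin (m + 1))) l,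
          ∑ j ∈ Finset.piAntidiag (Finset.univ : Finset (Fin (m + 1))) k with
              (∀ a, i a ≤ j a ∧ j a ≤ n - 1) ∧ ∀ a, a ≠ 0 → 1 ≤ j a,
            (∏ a, Polynomial.C (n.choose (j a + 1) : ℂ)) *
              (1 - Polynomial.X) ^ i 0 * (-Polynomial.X) ^ (l - i 0) := by
  have hn0 : (n : ℂ) ≠ 0 := Nat.cast_ne_zero.2 hn.ne'
  have hmul := powDiffQuot_mul_zBarInterp_series hn hζ
  rw [sumZBarInterp_eq_coeff]
  have hV : (n : (Polynomial ℂ)⟦X⟧⟦X⟧) * C (C (Polynomial.C (1 / (n : ℂ)))) = 1 := by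
    have e : (n : (Polynomial ℂ)⟦X⟧⟦X⟧) = C (C (Polynomial.C (n : ℂ))) := by simp
    rw [e, ← map_mul, ← map_mul, ← map_mul, mul_one_div_cancel hn0]
    simp
  rw [← add_sub_cancel (n : (Polynomial ℂ)⟦X⟧⟦X⟧)
    (powDiffQuot n (C X) (C (C (-Polynomial.X)) * X))] at hmul
  rw [coeff_coeff_eq_sum_of_mul_eq hV (dvd_powDiffQuot_sub hn _ _) hmul]
  refine Finset.sum_congr rfl fun m _ => ?_
  have e : (-1 : (Polynomial ℂ)⟦X⟧⟦X⟧) ^ m * C (C (Polynomial.C (1 / (n : ℂ)))) ^ (m + 1) =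
      C (C (Polynomial.C ((-1 : ℂ) ^ m / (n : ℂ) ^ (m + 1)))) := by
    rw [div_eq_mul_one_div ((-1 : ℂ) ^ m), ← one_div_pow]
    simp only [map_mul, map_pow, map_neg, map_one]
  rw [e, coeff_C_mul, coeff_C_mul]
  congr 1
  have hD : ∀ i j, coeff j (coeff i (powDiffQuot n (C X) (C (C (-Polynomial.X)) * X) -
      (n : (Polynomial ℂ)⟦X⟧⟦X⟧))) =
        if (i ≤ j ∧ j ≤ n - 1) ∧ 1 ≤ j then
          Polynomial.C (n.choose (j + 1) : ℂ) * (-Polynomial.X) ^ i else 0 := by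
    simpa only [map_natCast] using coeff_coeff_powDiffQuot_sub_natCast n (-Polynomial.X)
  exact coeff_coeff_mul_pow (P := fun i j => i ≤ j ∧ j ≤ n - 1) (Q := fun _ j => 1 ≤ j)
    (c := fun j => Polynomial.C (n.choose (j + 1) : ℂ)) (coeff_coeff_powDiffQuot_one_sub_X n)
    hD k l m

theorem powDiffQuot_zero_mul_C_zBarOne_series {n : ℕ} (hn : 0 < n) {ζ : ℂ}
    (hζ : IsPrimitiveRoot ζ n) :
    powDiffQuot n (C X) 0 * (C (C (Polynomial.C (-(1 / (n : ℂ))))) *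
      C (mk fun l => Polynomial.C (zBarOne n l ζ))) = (1 : (Polynomial ℂ)⟦X⟧⟦X⟧) := by
  have hn0 : (n : ℂ) ≠ 0 := Nat.cast_ne_zero.2 hn.ne'
  have h := congrArg (C (R := (Polynomial ℂ)⟦X⟧)) (powDiffQuot_zero_mul_zBarOne_series hn hζ)
  have e0 : C (powDiffQuot n (X : (Polynomial ℂ)⟦X⟧) 0) = powDiffQuot n (C X) 0 := by
    simp [powDiffQuot]
  have e1 : C (-(n : (Polynomial ℂ)⟦X⟧)) = C (C (Polynomial.C (-(n : ℂ)))) := by simp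
  rw [map_mul, e0, e1] at h
  rw [mul_left_comm, h, ← map_mul, ← map_mul, ← map_mul, neg_mul_neg,
    one_div_mul_cancel hn0]
  simp

theorem neg_one_pow_mul_neg_mul_pow {S : Type*} [CommRing S] (m : ℕ) (a b : S) :
    (-1) ^ m * (-a * b) ^ (m + 1) = -a ^ (m + 1) * b ^ (m + 1) := by
  have h : (-1 : S) ^ m * (-1) ^ m = 1 := by
    rw [← mul_pow]; simp
  rw [mul_pow, neg_pow a, pow_succ (-1)]
  linear_combination (-a ^ (m + 1) * b ^ (m + 1)) * h

theorem sumZBarInterp_eq_sum_choose_mul_zBarOne (n : ℕ) (hn : 0 < n) (ζ : ℂ)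
    (hζ : IsPrimitiveRoot ζ n) (k l : ℕ) :
    sumZBarInterp n k l ζ =
      -∑ m ∈ Finset.range (k + 1), Polynomial.C (1 / (n : ℂ) ^ (m + 1)) *
        ∑ i ∈ Finset.piAntidiag (Finset.univ : Finset (Fin (m + 1))) l,
          ∑ s ∈ Finset.HasAntidiagonal.antidiagonal k,
            ∑ e ∈ Finset.piAntidiag (Finset.univ : Finset (Fin (m + 1))) s.1,
              ∑ j ∈ Finset.piAntidiag (Finset.univ : Finset (Fin (m + 1))) s.2 with
                  (∀ a, i a ≤ j a ∧ j a ≤ n - 1) ∧ ∀ a, a ≠ 0 → 1 ≤ i a,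
                (∏ a, Polynomial.C ((n.choose (j a + 1) : ℂ) * zBarOne n (e a) ζ)) *
                  (1 - Polynomial.X) ^ i 0 * (-Polynomial.X) ^ (l - i 0) := by
  have hmul := powDiffQuot_mul_zBarInterp_series hn hζ
  rw [sumZBarInterp_eq_coeff]
  have hV := powDiffQuot_zero_mul_C_zBarOne_series hn hζ
  set Z : (Polynomial ℂ)⟦X⟧ := mk fun l => Polynomial.C (zBarOne n l ζ) with hZ
  rw [← add_sub_cancel (powDiffQuot n (C X) 0)
    (powDiffQuot n (C X) (C (C (-Polynomial.X)) * X))] at hmul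
  rw [coeff_coeff_eq_sum_of_mul_eq hV (dvd_powDiffQuot_sub_powDiffQuot hn _ _ _) hmul, ← Finset.sum_neg_distrib]
  refine Finset.sum_congr rfl fun m _ => ?_
  -- The inverse of P(0) brings (-1/n)^(m+1); against (-1)^m this leaves a single minus sign.
  have e : (-1 : (Polynomial ℂ)⟦X⟧⟦X⟧) ^ m *
      (C (C (Polynomial.C (-(1 / (n : ℂ))))) * C Z) ^ (m + 1) =
      C (C (-Polynomial.C (1 / (n : ℂ) ^ (m + 1))) * ∏ _a : Fin (m + 1), Z) := by
    rw [Finset.prod_const, Finset.card_univ, Fintype.card_fin, ← one_div_pow]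
    simp only [map_mul, map_pow, map_neg]
    exact neg_one_pow_mul_neg_mul_pow m _ _
  rw [e, coeff_C_mul, mul_assoc, coeff_C_mul, neg_mul]
  congr 2
  have hD : ∀ i j, coeff j (coeff i (powDiffQuot n (C X) (C (C (-Polynomial.X)) * X) -
      powDiffQuot n (C X) (0 : (Polynomial ℂ)⟦X⟧⟦X⟧))) =
        if (i ≤ j ∧ j ≤ n - 1) ∧ 1 ≤ i then
          Polynomial.C (n.choose (j + 1) : ℂ) * (-Polynomial.X) ^ i else 0 := by
    simpa only [map_natCast] using coeff_coeff_powDiffQuot_sub_zero n (-Polynomial.X)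
  rw [coeff_mul, Finset.sum_comm]
  refine Finset.sum_congr rfl fun s _ => ?_
  rw [coeff_prod_univ,
    coeff_coeff_mul_pow (P := fun i j => i ≤ j ∧ j ≤ n - 1) (Q := fun i _ => 1 ≤ i)
      (c := fun j => Polynomial.C (n.choose (j + 1) : ℂ)) (coeff_coeff_powDiffQuot_one_sub_X n) hD, Finset.mul_sum]
  refine Finset.sum_congr rfl fun i _ => ?_
  rw [Finset.sum_mul]
  refine Finset.sum_congr rfl fun e _ => ?_
  rw [Finset.mul_sum]
  refine Finset.sum_congr rfl fun j _ => ?_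
  simp only [map_mul, Finset.prod_mul_distrib, hZ, coeff_mk]
  ring

end

theorem corollary1p4 (n : ℕ) (hn : 0 < n) (ζ : ℂ) (hζ : IsPrimitiveRoot ζ n)
    (k l : ℕ) (hkl : l ≤ k) :
    (sumZBarInterp n k l ζ =
      ∑ m ∈ Finset.range (k + 1), Polynomial.C ((-1 : ℂ) ^ m / (n : ℂ) ^ (m + 1)) *
        ∑ i ∈ Finset.piAntidiag (Finset.univ : Finset (Fin (m + 1))) l,
          ∑ j ∈ Finset.piAntidiag (Finset.univ : Finset (Fin (m + 1))) k with
              (∀ a, i a ≤ j a ∧ j a ≤ n - 1) ∧ ∀ a, a ≠ 0 → 1 ≤ j a,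
            (∏ a, Polynomial.C (n.choose (j a + 1) : ℂ)) *
              (1 - Polynomial.X) ^ i 0 * (-Polynomial.X) ^ (l - i 0)) ∧
    (sumZBarInterp n k l ζ =
      -∑ m ∈ Finset.range (k + 1), Polynomial.C (1 / (n : ℂ) ^ (m + 1)) *
        ∑ i ∈ Finset.piAntidiag (Finset.univ : Finset (Fin (m + 1))) l,
          ∑ s ∈ Finset.HasAntidiagonal.antidiagonal k,
            ∑ e ∈ Finset.piAntidiag (Finset.univ : Finset (Fin (m + 1))) s.1,
              ∑ j ∈ Finset.piAntidiag (Finset.univ : Finset (Fin (m + 1))) s.2 with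
                  (∀ a, i a ≤ j a ∧ j a ≤ n - 1) ∧ ∀ a, a ≠ 0 → 1 ≤ i a,
                (∏ a, Polynomial.C ((n.choose (j a + 1) : ℂ) * zBarOne n (e a) ζ)) *
                  (1 - Polynomial.X) ^ i 0 * (-Polynomial.X) ^ (l - i 0)) := by
  exact ⟨sumZBarInterp_eq_sum_choose n hn ζ hζ k l,
    sumZBarInterp_eq_sum_choose_mul_zBarOne n hn ζ hζ k l⟩
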